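/- Let $A(t)$, $t\ge 0$, be a Poisson process of rate $R\ge 0$ (with $A\equiv 0$ if $R=0$). For a file of size $T\ge 0$ and an initial buffer $D\ge 0$ (real numbers), let the buffer size be $Q(t)=D+A(t)-t$, and put $$\tau_e=\inf\{t\ge 0: Q(t)\le 0\},\qquad \tau_f=\inf\{t\ge 0: Q(t)\ge T-t\}\qquad(\inf\emptyset=\infty).$$ Let $p(D)=\Pr\{\tau_e<\tau_f\}$ be the interruption probability, let $D^*(\varepsilon)=\min\{D\ge 0: p(D)\le\varepsilon\}$ be the minimum initial buffer size (which depends on $R$ and $T$), and let $\bar r(R)=\sup\{r\in\mathbb R: r+R(e^{-r}-1)=0\}$. Then: (a) For all $R>1$, $T\ge 0$ and $\varepsilon\ge 0$, $$D^*(\varepsilon)\ \ge\ -\frac{1}{\bar r(R)}\,\log\Big(\varepsilon+2\,e^{-\frac{(R-1)^2}{4(R+1)}T}\Big).$$ (b) For every $R$ with $0\le R\le 1$ there is a constant $C>0$ depending only on $R$ such that, for all $0<\varepsilon\le\frac1{16}$ and all $T\ge C\log\frac1\varepsilon$, $$D^*(\varepsilon)\ \ge\ T(1-R)+\frac12\Big(2TR\log\frac1\varepsilon\Big)^{1/2}.$$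 -/

import Mathlib

open MeasureTheory ProbabilityTheory
open scoped NNReal ENNReal

noncomputable section

namespace MediaStreaming

/-- `A` is a (homogeneous) Poisson process of rate `R ≥ 0` under `P`: almost every path starts at
`0`, is nondecreasing and right-continuous (`ℕ` carries the discrete topology, so the paths are
step functions); the increments are independent, and the increment over `[s, t]` is Poisson with
mean `R * (t - s)`. Since almost every path is nondecreasing, the truncated subtraction of `ℕ` is
almost surely the true increment. For `R = 0` the process is almost surely identically `0`. -/
structure IsPoissonProcess {Ω : Type*} [MeasurableSpace Ω] (P : Measure Ω) (R : ℝ)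
    (A : ℝ≥0 → Ω → ℕ) : Prop where
  measurable : ∀ t, Measurable (A t)
  zero : ∀ᵐ ω ∂P, A 0 ω = 0
  monotone : ∀ᵐ ω ∂P, Monotone fun t => A t ω
  rightCts : ∀ᵐ ω ∂P, ∀ t, ContinuousWithinAt (fun s => A s ω) (Set.Ici t) t
  indep : HasIndepIncrements A P
  law : ∀ s t, s ≤ t →
    P.map (fun ω => A t ω - A s ω) = poissonMeasure (R.toNNReal * (t - s))

variable {Ω : Type*}

/-- The buffer size `Q(t) = D + A(t) - t`. -/
def buffer (A : ℝ≥0 → Ω → ℕ) (D : ℝ) (t : ℝ≥0) (ω : Ω) : ℝ :=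
  D + (A t ω : ℝ) - (t : ℝ)

/-- `τ_e = inf {t ≥ 0 : Q(t) ≤ 0}`, with value `∞` if there is no such `t`. -/
def emptyTime (A : ℝ≥0 → Ω → ℕ) (D : ℝ) (ω : Ω) : ℝ≥0∞ :=
  sInf ((fun t : ℝ≥0 => (t : ℝ≥0∞)) '' {t : ℝ≥0 | buffer A D t ω ≤ 0})

/-- `τ_f = inf {t ≥ 0 : Q(t) ≥ T - t}`, with value `∞` if there is no such `t`. -/
def finishTime (A : ℝ≥0 → Ω → ℕ) (T D : ℝ) (ω : Ω) : ℝ≥0∞ :=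
  sInf ((fun t : ℝ≥0 => (t : ℝ≥0∞)) '' {t : ℝ≥0 | T - (t : ℝ) ≤ buffer A D t ω})

/-- The interruption probability `p(D) = Pr {τ_e < τ_f}`. -/
def interruptionProb [MeasurableSpace Ω] (P : Measure Ω) (A : ℝ≥0 → Ω → ℕ) (T D : ℝ) : ℝ :=
  P.real {ω | emptyTime A D ω < finishTime A T D ω}

/-- The minimum initial buffer size `D*(ε) = min {D ≥ 0 : p(D) ≤ ε}`, as an infimum (the set is
bounded below by `0`, and for `T, ε ≥ 0` it contains `T`). -/
def minBuffer [MeasurableSpace Ω] (P : Measure Ω) (A : ℝ≥0 → Ω → ℕ) (T ε : ℝ) : ℝ :=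
  sInf {D : ℝ | 0 ≤ D ∧ interruptionProb P A T D ≤ ε}

/-- `γ(r) = r + R (e^{-r} - 1)`. -/
def gammaFun (R r : ℝ) : ℝ := r + R * (Real.exp (-r) - 1)

/-- `r̄(R) = sup {r : γ(r) = 0}`, the largest root of `γ`. -/
def rBar (R : ℝ) : ℝ := sSup {r : ℝ | gammaFun R r = 0}

end MediaStreaming

end

/-! ### Optional stopping for a discretized buffer walk -/

namespace MediaStreaming

/-! Only paths that empty the buffer before time `T` are counted: up to such a time `t`, `D + A(s) ≤
t < T`, so playback has not finished. Both bounds are lower bounds for this probability.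

For `R > 1`, let `r` be the largest root of `γ`, so that `exp (-r Q)` is a martingale. Stop it at
emptying or at `T`. Emptying contributes at most its probability. A survivor has `Q(T) ≥ 0`, so for
`0 ≤ s ≤ r` its contribution is at most `exp (-s (A(T) - T))`, of mean `exp (T γ(s))`. Hence `exp
(-r D) ≤ exp (T γ(s)) + p(D)`, with `s = log R`. The argument runs on a grid
(`exp_le_lintegral_add`, `exp_le_of_grid`), whose overshoot factor `exp (r h)` tends to `1`.

For `0 < R ≤ 1`, if `y + D < T` and `A(T) ≤ y`, the buffer is empty by time `y + D`. So `p(D)`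
dominates a Poisson lower tail at `s` standard deviations below the mean. This tail is roughly `exp
(-s² / 2)`, and `exp_lt_poisson_lower_tail` only needs it to exceed `exp (-2 s²) = ε`. -/

/-- The position after `k` steps of the walk with start `D`, upward jumps `x i` and drift `-h`. -/
noncomputable def walk (D h : ℝ) (x : ℕ → ℕ) (k : ℕ) : ℝ :=
  D + ∑ i ∈ Finset.range k, (x i : ℝ) - k * h

theorem walk_zero (D h : ℝ) (x : ℕ → ℕ) : walk D h x 0 = D := by simp [walk]

theorem walk_succ (D h : ℝ) (x : ℕ → ℕ) (k : ℕ) :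
    walk D h x (k + 1) = walk D h x k + ((x k : ℝ) - h) := by
  simp only [walk, Finset.sum_range_succ]
  push_cast
  ring

theorem walk_congr (D h : ℝ) {x y : ℕ → ℕ} {k : ℕ} (hxy : ∀ i < k, x i = y i) :
    walk D h x k = walk D h y k := by
  simp only [walk]
  rw [Finset.sum_congr rfl fun i hi => by rw [hxy i (Finset.mem_range.1 hi)]]

/-- The walk is at least `-h` at the first time it is not positive. -/
theorem neg_le_walk {D h : ℝ} (hD : 0 ≤ D) (hh : 0 ≤ h) {x : ℕ → ℕ} {k : ℕ}
    (hpos : ∀ j < k, 0 < walk D h x j) : -h ≤ walk D h x k := by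
  rcases k with _ | k
  · rw [walk_zero]; linarith
  · rw [walk_succ]
    have h1 := hpos k (Nat.lt_succ_self k)
    have h2 : (0 : ℝ) ≤ x k := Nat.cast_nonneg _
    linarith

variable {Ω : Type*} [MeasurableSpace Ω]

theorem measurable_walk (D h : ℝ) {ξ : ℕ → Ω → ℕ} (hm : ∀ i, Measurable (ξ i)) (k : ℕ) :
    Measurable fun ω => walk D h (fun i => ξ i ω) k := by
  unfold walk
  have : ∀ i, Measurable fun ω => (ξ i ω : ℝ) := fun i => measurable_from_nat.comp (hm i)
  fun_prop

/-- The event that the walk stays positive before step `k`. -/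
def positiveBefore (D h : ℝ) (ξ : ℕ → Ω → ℕ) (k : ℕ) : Set Ω :=
  {ω | ∀ j < k, 0 < walk D h (fun i => ξ i ω) j}

theorem measurableSet_positiveBefore (D h : ℝ) {ξ : ℕ → Ω → ℕ} (hm : ∀ i, Measurable (ξ i))
    (k : ℕ) : MeasurableSet (positiveBefore D h ξ k) := by
  have : positiveBefore D h ξ k
      = ⋂ j, ⋂ (_ : j < k), {ω | 0 < walk D h (fun i => ξ i ω) j} := by
    ext ω; simp [positiveBefore]
  rw [this]
  exact MeasurableSet.iInter fun j => MeasurableSet.iInter fun _ =>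
    measurableSet_lt measurable_const (measurable_walk D h hm j)

variable {P : Measure Ω}

/-- A nonnegative functional of the first `k` steps is independent of the step `k`. -/
theorem lintegral_mul_step {ξ : ℕ → Ω → ℕ} (hm : ∀ i, Measurable (ξ i)) (hi : iIndepFun ξ P)
    (k : ℕ) (Φ : (ℕ → ℕ) → ℝ≥0∞) (hΦ : ∀ x y : ℕ → ℕ, (∀ i < k, x i = y i) → Φ x = Φ y)
    (f : ℕ → ℝ≥0∞) :
    ∫⁻ ω, Φ (fun i => ξ i ω) * f (ξ k ω) ∂P
      = (∫⁻ ω, Φ (fun i => ξ i ω) ∂P) * ∫⁻ ω, f (ξ k ω) ∂P := by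
  let F : (Finset.range k → ℕ) → ℝ≥0∞ := fun x =>
    Φ fun i => if h : i ∈ Finset.range k then x ⟨i, h⟩ else 0
  let g : (({k} : Finset ℕ) → ℕ) → ℝ≥0∞ := fun x => f (x ⟨k, Finset.mem_singleton_self k⟩)
  have hF : ∀ ω, Φ (fun i => ξ i ω) = F (fun i => ξ i ω) := fun ω => by
    refine hΦ _ _ fun i hi => ?_
    simp [hi]
  have hind := hi.indepFun_finset (Finset.range k) {k} (by simp) hm
  have hFm : Measurable F := measurable_of_countable F
  have hgm : Measurable g := measurable_of_countable g
  have hc := hind.comp hFm hgm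
  have hm1 : Measurable fun ω => F (fun i : Finset.range k => ξ i ω) :=
    hFm.comp (measurable_pi_lambda _ fun i => hm i)
  have hm2 : Measurable fun ω => g (fun i : ({k} : Finset ℕ) => ξ i ω) :=
    hgm.comp (measurable_pi_lambda _ fun i => hm i)
  simp_rw [hF]
  exact lintegral_mul_eq_lintegral_mul_lintegral_of_indepFun'' hm1.aemeasurable hm2.aemeasurable hc

/-- The optional stopping inequality for the exponential martingale of the walk, stopped when it
first fails to be positive. -/
theorem exp_le_lintegral_add [IsProbabilityMeasure P] {ξ : ℕ → Ω → ℕ}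
    (hm : ∀ i, Measurable (ξ i)) (hi : iIndepFun ξ P) {D h r : ℝ} (hD : 0 ≤ D) (hh : 0 ≤ h)
    (hr : 0 ≤ r) (hone : ∀ i, ∫⁻ ω, ENNReal.ofReal (Real.exp (-r * ((ξ i ω : ℝ) - h))) ∂P = 1)
    (k : ℕ) :
    ENNReal.ofReal (Real.exp (-r * D)) ≤
      ∫⁻ ω in positiveBefore D h ξ k,
          ENNReal.ofReal (Real.exp (-r * walk D h (fun i => ξ i ω) k)) ∂P
        + ENNReal.ofReal (Real.exp (r * h)) * P (positiveBefore D h ξ k)ᶜ := by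
  classical
  induction k with
  | zero =>
    have : positiveBefore D h ξ 0 = Set.univ := by ext ω; simp [positiveBefore]
    simp [this, walk_zero]
  | succ k ih =>
    set M : ℕ → Ω → ℝ≥0∞ := fun k ω =>
      ENNReal.ofReal (Real.exp (-r * walk D h (fun i => ξ i ω) k)) with hM
    set G := positiveBefore D h ξ with hG
    have hGm : ∀ k, MeasurableSet (G k) := measurableSet_positiveBefore D h hm
    have hsub : G (k + 1) ⊆ G k := fun ω hω j hj => hω j (hj.trans (Nat.lt_succ_self k))
    -- Positivity at positions `0, ..., k` involves only the first `k` increments, so the next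
    -- factor is independent and averages to `1`.
    have hstep : ∫⁻ ω in G (k + 1), M (k + 1) ω ∂P = ∫⁻ ω in G (k + 1), M k ω ∂P := by
      let Φ : (ℕ → ℕ) → ℝ≥0∞ := fun x =>
        if ∀ j < k + 1, 0 < walk D h x j then ENNReal.ofReal (Real.exp (-r * walk D h x k)) else 0
      have hΦ : ∀ x y : ℕ → ℕ, (∀ i < k, x i = y i) → Φ x = Φ y := by
        intro x y hxy
        have h1 : ∀ j ≤ k, walk D h x j = walk D h y j := fun j hj =>
          walk_congr D h fun i hi => hxy i (hi.trans_le hj)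
        have h2 : (∀ j < k + 1, 0 < walk D h x j) ↔ ∀ j < k + 1, 0 < walk D h y j :=
          forall₂_congr fun j hj => by rw [h1 j (Nat.lt_succ_iff.1 hj)]
        simp only [Φ, h2, h1 k le_rfl]
      have key := lintegral_mul_step hm hi k Φ hΦ
        (fun n => ENNReal.ofReal (Real.exp (-r * ((n : ℝ) - h))))
      rw [hone k, mul_one] at key
      rw [← lintegral_indicator (hGm _), ← lintegral_indicator (hGm _)]
      have e1 : ∀ ω, (G (k + 1)).indicator (M k) ω = Φ fun i => ξ i ω := fun ω => by
        simp only [Set.indicator, Φ, hG, positiveBefore, Set.mem_ofPred_eq, hM]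
      have e2 : ∀ ω, (G (k + 1)).indicator (M (k + 1)) ω
          = Φ (fun i => ξ i ω) * ENNReal.ofReal (Real.exp (-r * ((ξ k ω : ℝ) - h))) := fun ω => by
        rw [← e1 ω]
        by_cases hω : ω ∈ G (k + 1)
        · rw [Set.indicator_of_mem hω, Set.indicator_of_mem hω]
          simp only [hM]
          rw [← ENNReal.ofReal_mul (Real.exp_pos _).le, ← Real.exp_add, walk_succ]
          ring_nf
        · rw [Set.indicator_of_notMem hω, Set.indicator_of_notMem hω, zero_mul]
      simp_rw [e1, e2]
      exact key
    have hsplit : ∫⁻ ω in G k, M k ω ∂P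
        = ∫⁻ ω in G (k + 1), M k ω ∂P + ∫⁻ ω in G k \ G (k + 1), M k ω ∂P := by
      rw [← lintegral_inter_add_sdiff (M k) (G k) (hGm (k + 1)),
        Set.inter_eq_self_of_subset_right hsub]
    -- Paths that first fail at position `k` overshoot zero by at most `h`.
    have hdiff : ∫⁻ ω in G k \ G (k + 1), M k ω ∂P
        ≤ ENNReal.ofReal (Real.exp (r * h)) * P (G k \ G (k + 1)) := by
      rw [← setLIntegral_const]
      refine setLIntegral_mono' ((hGm k).diff (hGm _)) fun ω hω => ?_
      refine ENNReal.ofReal_le_ofReal (Real.exp_le_exp.2 ?_)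
      nlinarith [neg_le_walk hD hh hω.1]
    have hcompl : P (G (k + 1))ᶜ = P (G k)ᶜ + P (G k \ G (k + 1)) := by
      rw [← measure_union _ ((hGm k).diff (hGm _))]
      · congr 1
        ext ω
        have := @hsub ω
        simp only [Set.mem_compl_iff, Set.mem_union, Set.mem_sdiff]
        tauto
      · exact Set.disjoint_left.2 fun ω h1 h2 => h1 h2.1
    calc _ ≤ _ := ih
      _ ≤ _ := by
        rw [hstep, hcompl, hsplit, mul_add, add_assoc]
        gcongr 1
        rw [add_comm (_ * _)]
        gcongr

end MediaStreaming

/-! ### Exponential moments and the function `γ` -/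

namespace MediaStreaming

theorem lintegral_exp_poissonMeasure (m : ℝ≥0) (r c : ℝ) :
    ∫⁻ n, ENNReal.ofReal (Real.exp (-r * ((n : ℝ) - c))) ∂poissonMeasure m
      = ENNReal.ofReal (Real.exp (r * c + m * (Real.exp (-r) - 1))) := by
  have hs : HasSum (fun n : ℕ => Real.exp (-r * ((n : ℝ) - c)) *
      (Real.exp (-m) * (m : ℝ) ^ n / n.factorial))
      (Real.exp (r * c + m * (Real.exp (-r) - 1))) := by
    have h := (NormedSpace.expSeries_div_hasSum_exp ((m : ℝ) * Real.exp (-r))).mul_left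
      (Real.exp (r * c) * Real.exp (-m))
    rw [← Real.exp_eq_exp_ℝ] at h
    have hval : Real.exp (r * c) * Real.exp (-m) * Real.exp (m * Real.exp (-r))
        = Real.exp (r * c + m * (Real.exp (-r) - 1)) := by
      rw [← Real.exp_add, ← Real.exp_add]; ring_nf
    rw [hval] at h
    convert! h using 2 with n
    have : Real.exp (-r * ((n : ℝ) - c)) = Real.exp (r * c) * Real.exp (-r) ^ n := by
      rw [← Real.exp_nat_mul, ← Real.exp_add]; ring_nf
    rw [this, mul_pow]; ring
  rw [lintegral_countable']
  simp_rw [poissonMeasure_singleton, ← ENNReal.ofReal_mul (Real.exp_pos _).le]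
  rw [← ENNReal.ofReal_tsum_of_nonneg (fun n => by positivity) hs.summable, hs.tsum_eq]

/-- `γ` changes sign on `[R - 1, R]`, and its zero set is closed and bounded above, so the supremum
is attained. The lower bound makes `s = log R ≤ R - 1` admissible below `r̄`. -/
theorem gammaFun_bracket {R : ℝ} (hR : 1 < R) :
    0 < rBar R ∧ R - 1 ≤ rBar R ∧ gammaFun R (rBar R) = 0 := by
  have hcont : Continuous (gammaFun R) := by unfold gammaFun; fun_prop
  have hbdd : BddAbove {r : ℝ | gammaFun R r = 0} := by
    refine ⟨R, fun r hr => ?_⟩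
    have hr' : r + R * (Real.exp (-r) - 1) = 0 := hr
    nlinarith [Real.exp_pos (-r)]
  have hlo : gammaFun R (R - 1) ≤ 0 := by
    unfold gammaFun
    have h1 : R ≤ Real.exp (R - 1) := by linarith [Real.add_one_le_exp (R - 1)]
    have h2 : Real.exp (-(R - 1)) * Real.exp (R - 1) = 1 := by rw [← Real.exp_add]; simp
    nlinarith [Real.exp_pos (-(R - 1))]
  have hhi : 0 ≤ gammaFun R R := by
    unfold gammaFun
    have := mul_pos (show 0 < R by linarith) (Real.exp_pos (-R))
    linarith
  obtain ⟨r, hr, hr0⟩ := intermediate_value_Icc (by linarith : R - 1 ≤ R)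
    hcont.continuousOn ⟨hlo, hhi⟩
  have hle : R - 1 ≤ rBar R := hr.1.trans (le_csSup hbdd hr0)
  refine ⟨by linarith, hle, ?_⟩
  exact (isClosed_singleton.preimage hcont : IsClosed {r : ℝ | gammaFun R r = 0}).csSup_mem
    ⟨r, hr0⟩ hbdd

/-- `log R` minimizes `γ`. From `log √R ≤ √R - 1`, the minimum `log R + 1 - R` is at most `-(√R -
1)²`; then factor `R - 1` through `√R`. -/
theorem gammaFun_log_le {R : ℝ} (hR : 1 < R) :
    gammaFun R (Real.log R) ≤ -((R - 1) ^ 2 / (4 * (R + 1))) := by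
  have hR0 : 0 < R := by linarith
  have hs := Real.sq_sqrt hR0.le
  have hs1 : 1 < √R := by rw [Real.lt_sqrt] <;> linarith
  have hlog : Real.log R ≤ 2 * (√R - 1) := by
    conv_lhs => rw [← hs]
    rw [Real.log_pow]
    have := Real.log_le_sub_one_of_pos (show 0 < √R by linarith)
    push_cast
    linarith
  have hexp : R * (Real.exp (-Real.log R) - 1) = 1 - R := by
    rw [Real.exp_neg, Real.exp_log hR0]; field_simp
  unfold gammaFun
  rw [hexp, le_neg, div_le_iff₀ (by linarith)]
  have hb : (√R - 1) ^ 2 ≤ -(Real.log R + (1 - R)) := by nlinarith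
  have h1 : (R - 1) ^ 2 = (√R - 1) ^ 2 * (√R + 1) ^ 2 := by
    rw [← mul_pow]; congr 1; nlinarith
  have h2 : (√R + 1) ^ 2 ≤ 4 * (R + 1) := by nlinarith [sq_nonneg (√R - 1)]
  rw [h1]
  exact mul_le_mul hb h2 (by positivity) ((sq_nonneg _).trans hb)

/-! ### From an empty buffer to an interruption -/

variable {Ω : Type*}

/-- If the buffer is exhausted before time `T`, then the playback is interrupted. -/
theorem emptyTime_lt_finishTime {A : ℝ≥0 → Ω → ℕ} {ω : Ω} (hmono : Monotone fun t => A t ω)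
    (hcts : ∀ t, ContinuousWithinAt (fun s => A s ω) (Set.Ici t) t) {T D : ℝ} {t : ℝ≥0}
    (htT : (t : ℝ) < T) (ht : buffer A D t ω ≤ 0) :
    emptyTime A D ω < finishTime A T D ω := by
  -- Paths are locally constant to the right, so `A` is frozen on some `[t, u)`; this gives `τ_f ≥ u
  -- > t`, hence strictness.
  have hev : ∀ᶠ s in nhdsWithin t (Set.Ici t), A s ω = A t ω :=
    (hcts t).eventually (p := fun n => n = A t ω)
      (by rw [nhds_discrete]; exact Filter.eventually_pure.2 rfl)
  obtain ⟨u, htu, hu⟩ := mem_nhdsGE_iff_exists_Ico_subset.1 hev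
  refine lt_of_le_of_lt (sInf_le ⟨t, ht, rfl⟩) (lt_of_lt_of_le (ENNReal.coe_lt_coe.2 htu) ?_)
  refine le_sInf ?_
  rintro _ ⟨s, hs, rfl⟩
  refine ENNReal.coe_le_coe.2 (not_lt.1 fun hsu => ?_)
  have hle : A s ω ≤ A t ω := by
    rcases le_total s t with hst | hst
    · exact hmono hst
    · exact (hu ⟨hst, hsu⟩ : A s ω = A t ω).le
  have hle' : (A s ω : ℝ) ≤ A t ω := by exact_mod_cast hle
  simp only [Set.mem_ofPred_eq, buffer] at hs ht
  linarith

/-- The increments of `A` over the grid of mesh `h`. -/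
def gridIncrement (A : ℝ≥0 → Ω → ℕ) (h : ℝ≥0) (i : ℕ) (ω : Ω) : ℕ :=
  A ((i + 1 : ℕ) * h) ω - A (i * h) ω

theorem walk_gridIncrement {A : ℝ≥0 → Ω → ℕ} {ω : Ω} (h0 : A 0 ω = 0) (hmono : Monotone fun t => A t ω)
    (D : ℝ) (h : ℝ≥0) (k : ℕ) :
    walk D h (fun i => gridIncrement A h i ω) k = buffer A D (k * h) ω := by
  have hsum : (∑ i ∈ Finset.range k, (gridIncrement A h i ω : ℝ)) = A (k * h) ω := by
    induction k with
    | zero => simp [h0]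
    | succ k ih =>
      rw [Finset.sum_range_succ, ih, gridIncrement, Nat.cast_sub, add_sub_cancel]
      refine hmono (mul_le_mul_left ?_ h)
      exact_mod_cast Nat.le_succ k
  simp [walk, buffer, hsum]

variable [MeasurableSpace Ω] {P : Measure Ω} {R : ℝ} {A : ℝ≥0 → Ω → ℕ}

theorem interruptionProb_eq_zero_of_le (P : Measure Ω) (A : ℝ≥0 → Ω → ℕ) {T D : ℝ} (h : T ≤ D) :
    interruptionProb P A T D = 0 := by
  have : {ω | emptyTime A D ω < finishTime A T D ω} = ∅ := by
    refine Set.eq_empty_of_forall_notMem fun ω hω => ?_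
    have h0 : finishTime A T D ω ≤ ((0 : ℝ≥0) : ℝ≥0∞) := by
      refine sInf_le ⟨0, ?_, rfl⟩
      simp only [Set.mem_ofPred_eq, buffer, NNReal.coe_zero]
      have : (0 : ℝ) ≤ A 0 ω := Nat.cast_nonneg _
      linarith
    simp only [ENNReal.coe_zero, nonpos_iff_eq_zero] at h0
    simp [h0] at hω
  simp [interruptionProb, this]

/-- A lower bound for the minimum initial buffer size may be proved buffer size by buffer size. -/
theorem le_minBuffer {T ε b : ℝ} (hT : 0 ≤ T) (hε : 0 ≤ ε)
    (h : ∀ D, 0 ≤ D → interruptionProb P A T D ≤ ε → b ≤ D) : b ≤ minBuffer P A T ε :=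
  le_csInf ⟨T, hT, (interruptionProb_eq_zero_of_le P A le_rfl).trans_le hε⟩
    fun D hD => h D hD.1 hD.2

/-- The interruption probability dominates the probability of any event on which the buffer is
exhausted before time `T`. -/
theorem measure_le_interruptionProb [IsProbabilityMeasure P] (hA : IsPoissonProcess P R A)
    {T D : ℝ} {s : Set Ω}
    (hs : ∀ᵐ ω ∂P, ω ∈ s → ∃ t : ℝ≥0, (t : ℝ) < T ∧ buffer A D t ω ≤ 0) :
    P.real s ≤ interruptionProb P A T D := by
  refine ENNReal.toReal_mono (measure_ne_top _ _) (measure_mono_ae ?_)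
  filter_upwards [hs, hA.monotone, hA.rightCts] with ω h1 h2 h3 hω
  obtain ⟨t, htT, ht⟩ := h1 hω
  exact emptyTime_lt_finishTime h2 h3 htT ht

/-! ### The case `R > 1` -/

theorem IsPoissonProcess.lintegral_exp (hA : IsPoissonProcess P R A) (hR : 0 ≤ R) (r : ℝ)
    {s t : ℝ≥0} (hst : s ≤ t) :
    ∫⁻ ω, ENNReal.ofReal (Real.exp (-r * (((A t ω - A s ω : ℕ) : ℝ) - ((t - s : ℝ≥0) : ℝ)))) ∂P
      = ENNReal.ofReal (Real.exp ((t - s : ℝ≥0) * gammaFun R r)) := by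
  have hm : Measurable fun ω => A t ω - A s ω :=
    (measurable_of_countable fun p : ℕ × ℕ => p.1 - p.2).comp
      ((hA.measurable t).prodMk (hA.measurable s))
  have h := lintegral_exp_poissonMeasure (R.toNNReal * (t - s)) r ((t - s : ℝ≥0) : ℝ)
  rw [← hA.law s t hst, lintegral_map (measurable_of_countable _) hm] at h
  rw [h]
  congr 2
  rw [NNReal.coe_mul, Real.coe_toNNReal R hR, gammaFun]
  ring

/-- The discretized optional stopping bound with mesh `h = T / n`. -/
theorem exp_le_of_grid [IsProbabilityMeasure P] (hA : IsPoissonProcess P R A) (hR : 0 ≤ R)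
    {r s D : ℝ} (hr : 0 ≤ r) (hγ : gammaFun R r = 0) (hs : 0 ≤ s) (hsr : s ≤ r) (hD : 0 ≤ D)
    {h : ℝ≥0} (hh : 0 < h) {n : ℕ} :
    Real.exp (-r * D) ≤ Real.exp (r * h) *
      (Real.exp ((n * h : ℝ≥0) * gammaFun R s)
        + interruptionProb P A ((n * h : ℝ≥0) : ℝ) D) := by
  set ξ := gridIncrement A h with hξ
  have hm : ∀ i, Measurable (ξ i) := fun i =>
    (measurable_of_countable fun p : ℕ × ℕ => p.1 - p.2).comp
      ((hA.measurable _).prodMk (hA.measurable _))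
  have hgrid : Monotone fun i : ℕ => (i : ℝ≥0) * h := fun i j hij =>
    mul_le_mul_left (by exact_mod_cast hij) h
  have hstep : ∀ i : ℕ, ((i + 1 : ℕ) : ℝ≥0) * h - i * h = h := fun i => by
    push_cast; rw [add_mul, one_mul, add_tsub_cancel_left]
  have hi : iIndepFun ξ P := hA.indep.nat hgrid
  have hone : ∀ i, ∫⁻ ω, ENNReal.ofReal (Real.exp (-r * ((ξ i ω : ℝ) - h))) ∂P = 1 := by
    intro i
    have := hA.lintegral_exp hR r (hgrid (Nat.le_succ i))
    simp only [Nat.succ_eq_add_one, hstep, hγ] at this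
    simpa [hξ, gridIncrement] using this
  have hwalk : ∀ᵐ ω ∂P, ∀ k : ℕ,
      walk D h (fun i => ξ i ω) k = buffer A D (k * h) ω := by
    filter_upwards [hA.zero, hA.monotone] with ω h0 hmono k
    exact walk_gridIncrement h0 hmono D h k
  set G := positiveBefore D (h : ℝ) ξ n with hG
  have hGm : MeasurableSet G := measurableSet_positiveBefore D h hm n
  have hmain := exp_le_lintegral_add hm hi hD h.coe_nonneg hr hone n
  -- A survivor ends at `w ≥ -h`, so `-r w = -(r - s) w - s w ≤ r h - s (w - D)`, and `w - D` is the
  -- net input over `[0, n h]`.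
  have hterm : ∫⁻ ω in G, ENNReal.ofReal (Real.exp (-r * walk D h (fun i => ξ i ω) n)) ∂P
      ≤ ENNReal.ofReal (Real.exp (r * h)) *
        ENNReal.ofReal (Real.exp ((n * h : ℝ≥0) * gammaFun R s)) := by
    have hlaw := hA.lintegral_exp hR s (zero_le : (0 : ℝ≥0) ≤ n * h)
    rw [tsub_zero] at hlaw
    rw [← hlaw, ← lintegral_const_mul']
    swap
    · exact ENNReal.ofReal_ne_top
    refine (setLIntegral_mono_ae' hGm ?_).trans (setLIntegral_le_lintegral G _)
    filter_upwards [hwalk, hA.zero] with ω hω h0 hωG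
    rw [← ENNReal.ofReal_mul (Real.exp_pos _).le, ← Real.exp_add]
    refine ENNReal.ofReal_le_ofReal (Real.exp_le_exp.2 ?_)
    have h1 := neg_le_walk hD h.coe_nonneg hωG
    rw [h0, Nat.sub_zero]
    have h2 := hω n
    rw [buffer] at h2
    have h3 : (A (n * h) ω : ℝ) - ((n * h : ℝ≥0) : ℝ)
        = walk D h (fun i => ξ i ω) n - D := by rw [h2]; ring
    rw [h3]
    have hh' : (0 : ℝ) ≤ h := h.coe_nonneg
    nlinarith [mul_nonneg hs hD, mul_nonneg (sub_nonneg.2 hsr)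
      (show 0 ≤ walk D h (fun i => ξ i ω) n + h by linarith), mul_nonneg hs hh']
  -- `G` only tests positions `j < n`, so failure occurs strictly before the horizon `n h`.
  have hint : P.real Gᶜ ≤ interruptionProb P A ((n * h : ℝ≥0) : ℝ) D := by
    refine measure_le_interruptionProb hA ?_
    filter_upwards [hwalk] with ω hω hωG
    simp only [hG, positiveBefore, Set.mem_compl_iff, Set.mem_ofPred_eq, not_forall, not_lt] at hωG
    obtain ⟨j, hj, hle⟩ := hωG
    refine ⟨j * h, ?_, (hω j) ▸ hle⟩
    refine NNReal.coe_lt_coe.2 (mul_lt_mul_of_pos_right (by exact_mod_cast hj) hh)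
  have hfin := hmain.trans (add_le_add_left hterm _)
  have hPG : P Gᶜ = ENNReal.ofReal (P.real Gᶜ) := by simp [measureReal_def]
  rw [hPG, ← mul_add, ← ENNReal.ofReal_add (Real.exp_pos _).le measureReal_nonneg,
    ← ENNReal.ofReal_mul (Real.exp_pos _).le,
    ENNReal.ofReal_le_ofReal_iff (by positivity)] at hfin
  exact hfin.trans (mul_le_mul_of_nonneg_left (by linarith) (Real.exp_pos _).le)

theorem exp_le_add_interruptionProb [IsProbabilityMeasure P] (hA : IsPoissonProcess P R A)
    (hR : 0 ≤ R) {r s D T : ℝ} (hr : 0 ≤ r) (hγ : gammaFun R r = 0) (hs : 0 ≤ s) (hsr : s ≤ r)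
    (hD : 0 ≤ D) (hT : 0 < T) :
    Real.exp (-r * D) ≤ Real.exp (T * gammaFun R s) + interruptionProb P A T D := by
  have hlim : Filter.Tendsto (fun n : ℕ => Real.exp (r * (T / ((n : ℝ) + 1))) *
      (Real.exp (T * gammaFun R s) + interruptionProb P A T D)) Filter.atTop
      (nhds (Real.exp (r * 0) * (Real.exp (T * gammaFun R s) + interruptionProb P A T D))) := by
    refine Filter.Tendsto.mul_const _ ((Real.continuous_exp.tendsto _).comp
      (Filter.Tendsto.const_mul _ ?_))
    have := (tendsto_one_div_add_atTop_nhds_zero_nat (𝕜 := ℝ)).const_mul T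
    simpa [div_eq_mul_inv] using this
  rw [mul_zero, Real.exp_zero, one_mul] at hlim
  refine ge_of_tendsto' hlim fun n => ?_
  have hn : (0 : ℝ) < (n : ℝ) + 1 := by positivity
  have hpos : 0 < T / ((n : ℝ) + 1) := by positivity
  have := exp_le_of_grid hA hR hr hγ hs hsr hD (h := NNReal.mk _ hpos.le)
    (by exact_mod_cast hpos) (n := n + 1)
  have hc : (((n + 1 : ℕ) : ℝ≥0) * NNReal.mk _ hpos.le : ℝ≥0) = (T : ℝ) := by
    rw [NNReal.coe_mul, NNReal.coe_natCast, NNReal.coe_mk]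
    push_cast
    field_simp
  rw [hc] at this
  exact this

/-- The lower bound on the initial buffer size when the arrival rate exceeds the playback rate. -/
theorem neg_log_le_minBuffer [IsProbabilityMeasure P] (hR : 1 < R) (hA : IsPoissonProcess P R A)
    {T ε : ℝ} (hT : 0 ≤ T) (hε : 0 ≤ ε) :
    -(1 / rBar R) * Real.log (ε + 2 * Real.exp (-((R - 1) ^ 2 / (4 * (R + 1))) * T))
      ≤ minBuffer P A T ε := by
  obtain ⟨hr0, hr1, hr⟩ := gammaFun_bracket hR
  refine le_minBuffer hT hε fun D hD hp => ?_
  have hE := Real.exp_pos (-((R - 1) ^ 2 / (4 * (R + 1))) * T)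
  have key : Real.exp (-rBar R * D)
      ≤ ε + 2 * Real.exp (-((R - 1) ^ 2 / (4 * (R + 1))) * T) := by
    rcases hT.eq_or_lt with rfl | hT
    · rw [mul_zero, Real.exp_zero]
      have := Real.exp_le_one_iff.2 (show -rBar R * D ≤ 0 by nlinarith)
      linarith
    · have h := exp_le_add_interruptionProb hA (by linarith) hr0.le hr (Real.log_nonneg hR.le)
        ((Real.log_le_sub_one_of_pos (by linarith)).trans hr1) hD hT
      have h2 : Real.exp (T * gammaFun R (Real.log R))
          ≤ Real.exp (-((R - 1) ^ 2 / (4 * (R + 1))) * T) := by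
        rw [mul_comm T]
        exact Real.exp_le_exp.2 (mul_le_mul_of_nonneg_right (gammaFun_log_le hR) hT.le)
      linarith
  have hlog := (Real.le_log_iff_exp_le (by linarith)).2 key
  rw [neg_mul, one_div, inv_mul_eq_div, ← neg_div, div_le_iff₀ hr0]
  linarith

end MediaStreaming

/-! ### Gaussian lower bound for the Poisson lower tail -/

namespace MediaStreaming

/-- The Stirling sequence decreases from its first value `e / √2`, whence the constant `e` in place
of `√(2π)`. -/
theorem factorial_le_stirling {k : ℕ} (hk : 1 ≤ k) :
    (k.factorial : ℝ) ≤ Real.exp 1 * √k * (k / Real.exp 1) ^ k := by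
  have h := Stirling.stirlingSeq'_antitone (Nat.zero_le (k - 1))
  simp only [Function.comp, Nat.succ_eq_add_one, Nat.sub_add_cancel hk, zero_add,
    Stirling.stirlingSeq_one] at h
  have hk0 : (0 : ℝ) < k := by exact_mod_cast hk
  rw [Stirling.stirlingSeq, div_le_iff₀ (by positivity)] at h
  refine h.trans_eq ?_
  rw [Real.sqrt_mul (by norm_num)]
  field_simp

theorem log_one_sub_le {v : ℝ} (h0 : 0 ≤ v) (h1 : v < 1) :
    Real.log (1 - v) ≤ -v - v ^ 2 / 2 := by
  have h := Real.hasSum_pow_div_log_of_abs_lt_one (abs_lt.2 ⟨by linarith, h1⟩)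
  have h2 := sum_le_hasSum (Finset.range 2) (fun i _ => by positivity) h
  norm_num [Finset.sum_range_succ] at h2
  linarith

/-- A Gaussian lower bound for the Poisson probabilities below the mean `q ^ 2`. -/
theorem le_poisson_mass {q : ℝ} (hq : 0 < q) {k : ℕ} (hk : 1 ≤ k) {v : ℝ} (hv : 0 ≤ v)
    (hkv : (k : ℝ) = q ^ 2 * (1 - v)) :
    1 / (Real.exp 1 * q) * Real.exp (-(q ^ 2 * v ^ 2 * (1 + v) / 2))
      ≤ Real.exp (-q ^ 2) * (q ^ 2) ^ k / k.factorial := by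
  have hk0 : (0 : ℝ) < k := by exact_mod_cast hk
  have hq2 : 0 < q ^ 2 := by positivity
  have hv1 : 0 < 1 - v := pos_of_mul_pos_right (hkv ▸ hk0) hq2.le
  have hsq : √(k : ℝ) ≤ q := by
    rw [Real.sqrt_le_left hq.le, hkv]
    nlinarith
  have hpow : (k / Real.exp 1) ^ k
      = (q ^ 2) ^ k * Real.exp (k * Real.log (1 - v) - k) := by
    rw [Real.exp_sub, mul_comm (k : ℝ), Real.exp_mul, Real.exp_log hv1, Real.rpow_natCast,
      ← mul_one_div _ (Real.exp k), ← mul_assoc, ← mul_pow, ← hkv, div_pow, ← Real.exp_nat_mul,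
      mul_one, mul_one_div]
  rw [le_div_iff₀ (by positivity)]
  calc 1 / (Real.exp 1 * q) * Real.exp (-(q ^ 2 * v ^ 2 * (1 + v) / 2)) * k.factorial
      ≤ 1 / (Real.exp 1 * q) * Real.exp (-(q ^ 2 * v ^ 2 * (1 + v) / 2))
        * (Real.exp 1 * q * ((q ^ 2) ^ k * Real.exp (k * Real.log (1 - v) - k))) := by
        refine mul_le_mul_of_nonneg_left ((factorial_le_stirling hk).trans ?_) (by positivity)
        rw [hpow]
        gcongr
    _ = (q ^ 2) ^ k * Real.exp (-(q ^ 2 * v ^ 2 * (1 + v) / 2)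
          + (k * Real.log (1 - v) - k)) := by
        rw [Real.exp_add]; field_simp
    _ ≤ (q ^ 2) ^ k * Real.exp (-q ^ 2) := by
        gcongr
        -- With `k = q² (1 - v)` the terms linear in `v` cancel, leaving exactly `q² (-1 + v² / 2 +
        -- v³ / 2)`.
        have h := mul_le_mul_of_nonneg_left (log_one_sub_le hv (by linarith)) hk0.le
        rw [hkv] at h ⊢
        nlinarith
    _ = _ := mul_comm _ _

/-- Here `v ≤ (s + b) / q ≤ 0.001 + 0.0012`, so `(1 + v) / 2 ≤ 0.5011`. -/
theorem le_poisson_mass_of_near {q s b : ℝ} (hs : 0 ≤ s) (hqs : 1000 * s ≤ q) (hq : 1000 ≤ q)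
    (hb : b ≤ 1.2) {k : ℕ} (hk : (k : ℝ) ≤ q ^ 2)
    (hkb : q ^ 2 - k ≤ (s + b) * q) :
    1 / (Real.exp 1 * q) * Real.exp (-(0.5011 * (s + b) ^ 2))
      ≤ Real.exp (-q ^ 2) * (q ^ 2) ^ k / k.factorial := by
  have hq0 : 0 < q := by linarith
  have hk1 : 1 ≤ k := by
    have : (0 : ℝ) < k := by nlinarith
    exact_mod_cast this
  have hv : 0 ≤ 1 - k / q ^ 2 := sub_nonneg.2 ((div_le_one (by positivity)).2 hk)
  refine le_trans ?_ (le_poisson_mass hq0 hk1 hv (by field_simp; ring))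
  gcongr
  set v := 1 - k / q ^ 2 with hvd
  have hqv : q * v ≤ s + b := by
    refine le_of_mul_le_mul_right ?_ hq0
    refine le_trans (le_of_eq ?_) hkb
    rw [hvd]; field_simp
  have hqv0 : 0 ≤ q * v := by positivity
  have hv2 : v ≤ 0.0022 := by
    refine le_of_mul_le_mul_left (hqv.trans ?_) hq0
    linarith
  have h1 : (q * v) ^ 2 ≤ (s + b) ^ 2 := pow_le_pow_left₀ hqv0 hqv 2
  nlinarith [sq_nonneg (q * v), mul_le_mul_of_nonneg_left hv2 (sq_nonneg (q * v))]

/-- Each exponent gap `2 s² - 0.5011 (s + b)²` increases on this range; `1.52`, `0.81`, `-0.061` are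
its values at `s = 1.177`, rounded down. -/
theorem gaussian_blocks {s : ℝ} (hs : 1.177 ≤ s) :
    7.42 * Real.exp (-(2 * s ^ 2)) ≤ Real.exp (-(0.5011 * (s + 0.4) ^ 2))
      + Real.exp (-(0.5011 * (s + 0.8) ^ 2)) + Real.exp (-(0.5011 * (s + 1.2) ^ 2)) := by
  have cubic : ∀ x : ℝ, 0 ≤ x → 1 + x + x ^ 2 / 2 + x ^ 3 / 6 ≤ Real.exp x := fun x hx => by
    have := Real.sum_le_exp_of_nonneg hx 4
    norm_num [Finset.sum_range_succ, Nat.factorial] at this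
    linarith
  have block : ∀ b c e : ℝ, e ≤ Real.exp c → c ≤ 2 * s ^ 2 - 0.5011 * (s + b) ^ 2 →
      e * Real.exp (-(2 * s ^ 2)) ≤ Real.exp (-(0.5011 * (s + b) ^ 2)) := fun b c e he hc => by
    refine (mul_le_mul_of_nonneg_right he (Real.exp_pos _).le).trans ?_
    rw [← Real.exp_add]
    exact Real.exp_le_exp.2 (by linarith)
  have h1 := block 0.4 1.52 4.26 (le_trans (by norm_num) (cubic 1.52 (by norm_num)))
    (by nlinarith)
  have h2 := block 0.8 0.81 2.226 (le_trans (by norm_num) (cubic 0.81 (by norm_num)))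
    (by nlinarith)
  have h3 := block 1.2 (-0.061) 0.939 (le_trans (by norm_num) (Real.add_one_le_exp _))
    (by nlinarith)
  nlinarith [Real.exp_pos (-(2 * s ^ 2))]

/-- A lower bound of Gaussian type for the lower tail of the Poisson law of mean `q ^ 2`. -/
theorem exp_lt_poisson_lower_tail {m : ℝ≥0} {q s : ℝ} (hm : (m : ℝ) = q ^ 2) (hs : 1.177 ≤ s)
    (hqs : 1000 * s ≤ q) :
    Real.exp (-(2 * s ^ 2)) < (poissonMeasure m).real {k : ℕ | (k : ℝ) ≤ q ^ 2 - s * q} := by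
  have hq : 1000 ≤ q := by linarith
  have hq0 : 0 < q := by linarith
  -- The tail is bounded below by three blocks of `J` consecutive integers descending from `n`, each
  -- about `0.4` standard deviations wide.
  set n := ⌊q ^ 2 - s * q⌋₊ with hn
  set J := ⌊0.4 * q⌋₊ with hJ
  have hy : 0 ≤ q ^ 2 - s * q := by nlinarith
  have hn1 : (n : ℝ) ≤ q ^ 2 - s * q := Nat.floor_le hy
  have hn2 : q ^ 2 - s * q < n + 1 := Nat.lt_floor_add_one _
  have hJ1 : (J : ℝ) ≤ 0.4 * q := Nat.floor_le (by positivity)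
  have hJ2 : 0.4 * q < J + 1 := Nat.lt_floor_add_one _
  have hJn : J + J + J ≤ n := by
    have : ((J + J + J : ℕ) : ℝ) ≤ n := by push_cast; nlinarith
    exact_mod_cast this
  set f : ℕ → ℝ := fun k => Real.exp (-q ^ 2) * (q ^ 2) ^ k / k.factorial with hf
  have hsum : ∑ i ∈ Finset.range (J + J + J), f (n - i)
      ≤ (poissonMeasure m).real {k : ℕ | (k : ℝ) ≤ q ^ 2 - s * q} := by
    have hinj : Set.InjOn (fun i => n - i) (Finset.range (J + J + J) : Set ℕ) := by
      intro i hi j hj hij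
      simp only [Finset.coe_range, Set.mem_Iio] at hi hj hij
      omega
    have hfm : ∀ k, f k = (poissonMeasure m).real {k} := fun k => by
      rw [poissonMeasure_real_singleton, hm]
    rw [← Finset.sum_image (f := f) hinj]
    simp_rw [hfm]
    rw [sum_measureReal_singleton]
    refine measureReal_mono fun k hk => ?_
    simp only [Finset.coe_image, Set.mem_image] at hk
    obtain ⟨i, -, rfl⟩ := hk
    exact le_trans (by exact_mod_cast Nat.sub_le n i) hn1
  have hblock : ∀ (b : ℝ) (a : ℕ), b ≤ 1.2 → a + J ≤ n → ((a + J : ℕ) : ℝ) ≤ b * q →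
      J * (1 / (Real.exp 1 * q) * Real.exp (-(0.5011 * (s + b) ^ 2)))
        ≤ ∑ i ∈ Finset.range J, f (n - (a + i)) := by
    intro b a hb haJ hab
    have := Finset.card_nsmul_le_sum (Finset.range J) (fun i => f (n - (a + i)))
      (1 / (Real.exp 1 * q) * Real.exp (-(0.5011 * (s + b) ^ 2))) fun i hi => by
        have hi' := Finset.mem_range.1 hi
        have hcast : ((n - (a + i) : ℕ) : ℝ) = n - (a + i) := by
          rw [Nat.cast_sub (by omega)]; push_cast; ring
        -- This spare `1` absorbs the rounding loss in `n > q² - s q - 1`.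
        have hai : (a : ℝ) + i + 1 ≤ (a + J : ℕ) := by exact_mod_cast (by omega)
        have hi0 : (0 : ℝ) ≤ (a : ℝ) + i := by positivity
        refine le_poisson_mass_of_near (by linarith) hqs hq hb ?_ ?_
        · rw [hcast]; nlinarith
        · rw [hcast]; nlinarith
    simpa using this
  have hb1 := hblock 0.4 0 (by norm_num) (by omega) (by push_cast; linarith)
  have hb2 := hblock 0.8 J (by norm_num) (by omega) (by push_cast; linarith)
  have hb3 := hblock 1.2 (J + J) (by norm_num) (by omega) (by push_cast; linarith)
  simp only [zero_add] at hb1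
  rw [Finset.sum_range_add, Finset.sum_range_add] at hsum
  have hg := gaussian_blocks hs
  -- `0.4 / e` is about `0.147`, and the floor costs at most `1 / (1000 e)`; then `0.146 * 7.42 >
  -- 1`.
  have hcoef : 0.146 ≤ J * (1 / (Real.exp 1 * q)) := by
    rw [mul_one_div, le_div_iff₀ (by positivity)]
    have := mul_le_mul_of_nonneg_right Real.exp_one_lt_d9.le hq0.le
    linarith
  have hE := Real.exp_pos (-(2 * s ^ 2))
  set E := Real.exp (-(2 * s ^ 2))
  set E1 := Real.exp (-(0.5011 * (s + 0.4) ^ 2))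
  set E2 := Real.exp (-(0.5011 * (s + 0.8) ^ 2))
  set E3 := Real.exp (-(0.5011 * (s + 1.2) ^ 2))
  have hfin := mul_le_mul hcoef hg (by positivity) (by positivity)
  calc E < 0.146 * (7.42 * E) := by linarith
    _ ≤ _ := hfin
    _ = J * (1 / (Real.exp 1 * q) * E1) + J * (1 / (Real.exp 1 * q) * E2)
        + J * (1 / (Real.exp 1 * q) * E3) := by ring
    _ ≤ _ := (add_le_add (add_le_add hb1 hb2) hb3).trans hsum

/-! ### The case `R ≤ 1` -/

variable {Ω : Type*} [MeasurableSpace Ω] {P : Measure Ω} {R : ℝ} {A : ℝ≥0 → Ω → ℕ}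

/-- If few enough arrivals by time `T` are likely, then the playback is likely interrupted. -/
theorem poisson_le_interruptionProb [IsProbabilityMeasure P] (hA : IsPoissonProcess P R A)
    {T : ℝ≥0} {D y : ℝ} (hD : 0 ≤ D) (hy : 0 ≤ y) (hyT : y + D < T) :
    (poissonMeasure (R.toNNReal * T)).real {k : ℕ | (k : ℝ) ≤ y} ≤ interruptionProb P A T D := by
  have hlaw := hA.law 0 T zero_le
  rw [tsub_zero] at hlaw
  have hm : Measurable fun ω => A T ω - A 0 ω :=
    (measurable_of_countable fun p : ℕ × ℕ => p.1 - p.2).comp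
      ((hA.measurable T).prodMk (hA.measurable 0))
  rw [← hlaw, map_measureReal_apply hm (MeasurableSet.of_discrete)]
  refine measure_le_interruptionProb hA ?_
  filter_upwards [hA.zero, hA.monotone] with ω h0 hmono hω
  simp only [Set.mem_preimage, Set.mem_ofPred_eq, h0, Nat.sub_zero] at hω
  refine ⟨⟨y + D, by positivity⟩, hyT, ?_⟩
  have hle : A ⟨y + D, by positivity⟩ ω ≤ A T ω := hmono (by exact_mod_cast hyT.le)
  have hle' : (A ⟨y + D, by positivity⟩ ω : ℝ) ≤ A T ω := by exact_mod_cast hle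
  change D + (A ⟨y + D, _⟩ ω : ℝ) - (y + D) ≤ 0
  linarith

/-- The lower bound on the initial buffer size when the arrival rate does not exceed the playback
rate. -/
theorem add_sqrt_le_minBuffer [IsProbabilityMeasure P] (hR : 0 < R)
    (hA : IsPoissonProcess P R A) {T ε : ℝ} (hε : 0 < ε) (hε' : ε ≤ 1 / 16)
    (hT : 2000000 / R * Real.log (1 / ε) ≤ T) :
    T * (1 - R) + (1 / 2) * √(2 * T * R * Real.log (1 / ε)) ≤ minBuffer P A T ε := by
  set l := Real.log (1 / ε) with hl
  have hl1 : 4 * Real.log 2 ≤ l := by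
    have h16 : 4 * Real.log 2 = Real.log 16 := by
      rw [show (16 : ℝ) = 2 ^ 4 by norm_num, Real.log_pow]; norm_num
    rw [h16]
    refine Real.log_le_log (by norm_num) ?_
    rw [le_div_iff₀ hε]; linarith
  have hl2 : 2.77 ≤ l := by linarith [Real.log_two_gt_d9]
  have hεl : Real.exp (-l) = ε := by
    rw [hl, one_div, Real.log_inv, neg_neg, Real.exp_log hε]
  have hTR : 2000000 * l ≤ T * R := by
    rw [div_mul_eq_mul_div, div_le_iff₀ hR] at hT; exact hT
  have hT0 : 0 ≤ T := nonneg_of_mul_nonneg_left (by linarith) hR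
  have hTR0 : 0 ≤ T * R := by positivity
  set q := √(T * R) with hq
  set s := √(l / 2) with hs
  have hq2 : q ^ 2 = T * R := Real.sq_sqrt hTR0
  have hs2 : 2 * s ^ 2 = l := by rw [hs, Real.sq_sqrt (by linarith)]; ring
  -- `ε ≤ 1/16` gives `s ≥ √(2 log 2)`, about `1.1774`.
  have hs1 : 1.177 ≤ s := Real.le_sqrt_of_sq_le (by linarith [Real.log_two_gt_d9])
  -- The constant `2000000` even gives `q ≥ 2000 s`.
  have hqs : 1000 * s ≤ q := Real.le_sqrt_of_sq_le (by nlinarith)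
  have hroot : (1 / 2) * √(2 * T * R * l) = s * q := by
    have : 2 * T * R * l = (2 * (s * q)) ^ 2 := by
      rw [← hs2]; linear_combination (-4 * s ^ 2) * hq2
    rw [this, Real.sqrt_sq (by positivity)]; ring
  rw [hroot]
  refine le_minBuffer hT0 hε.le fun D hD hp => ?_
  by_contra! hlt
  lift T to ℝ≥0 using hT0
  have htail := exp_lt_poisson_lower_tail (m := R.toNNReal * T)
    (by rw [NNReal.coe_mul, Real.coe_toNNReal R hR.le, hq2, mul_comm]) hs1 hqs
  rw [hs2, hεl] at htail
  refine absurd hp (not_le.2 (htail.trans_le (poisson_le_interruptionProb hA hD ?_ ?_)))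
  · nlinarith
  · rw [hq2]; linarith

/-- With no arrivals, every `D < T` is interrupted almost surely. -/
theorem le_minBuffer_of_rate_zero [IsProbabilityMeasure P] (hA : IsPoissonProcess P 0 A)
    {T ε : ℝ} (hT : 0 ≤ T) (hε : 0 ≤ ε) (hε' : ε < 1) : T ≤ minBuffer P A T ε := by
  refine le_minBuffer hT hε fun D hD hp => ?_
  by_contra! hlt
  lift T to ℝ≥0 using hT
  have h := poisson_le_interruptionProb hA hD le_rfl (by rwa [zero_add])
  have h1 : {k : ℕ | (k : ℝ) ≤ 0} = {0} := by ext k; simp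
  rw [h1, poissonMeasure_real_singleton] at h
  simp at h
  linarith

end MediaStreaming

theorem theorem2 :
    (∀ R : ℝ, 1 < R →
      ∀ (Ω : Type*) [MeasurableSpace Ω] (P : Measure Ω) [IsProbabilityMeasure P]
        (A : ℝ≥0 → Ω → ℕ), MediaStreaming.IsPoissonProcess P R A →
      ∀ T ε : ℝ, 0 ≤ T → 0 ≤ ε →
        -(1 / MediaStreaming.rBar R) *
            Real.log (ε + 2 * Real.exp (-((R - 1) ^ 2 / (4 * (R + 1))) * T))
          ≤ MediaStreaming.minBuffer P A T ε) ∧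
    (∀ R : ℝ, 0 ≤ R → R ≤ 1 → ∃ C : ℝ, 0 < C ∧
      ∀ (Ω : Type*) [MeasurableSpace Ω] (P : Measure Ω) [IsProbabilityMeasure P]
        (A : ℝ≥0 → Ω → ℕ), MediaStreaming.IsPoissonProcess P R A →
      ∀ T ε : ℝ, 0 < ε → ε ≤ 1 / 16 → C * Real.log (1 / ε) ≤ T →
        T * (1 - R) + (1 / 2) * Real.sqrt (2 * T * R * Real.log (1 / ε))
          ≤ MediaStreaming.minBuffer P A T ε) := by
  refine ⟨fun R hR Ω _ P _ A hA T ε hT hε => MediaStreaming.neg_log_le_minBuffer hR hA hT hε,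
    fun R hR _ => ?_⟩
  rcases hR.eq_or_lt with rfl | hR
  · refine ⟨1, one_pos, fun Ω _ P _ A hA T ε hε hε' hT => ?_⟩
    have hlog : 0 ≤ Real.log (1 / ε) :=
      Real.log_nonneg (by rw [le_div_iff₀ hε]; linarith)
    simpa using MediaStreaming.le_minBuffer_of_rate_zero hA (by linarith) hε.le (by linarith)
  · exact ⟨2000000 / R, by positivity, fun Ω _ P _ A hA T ε hε hε' hT =>
      MediaStreaming.add_sqrt_le_minBuffer hR hA hε hε' hT⟩
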